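/- **Types.** Fix sets of participants, of exchanged value types $U$ and of labels $l$; a message $m$ is either a value $\langle U\rangle$ or a label $l$. Global types are given by $$G ::= p\to q:\langle U\rangle;G \;\mid\; p\to q:\{l_i:G_i\}_{i\in I} \;\mid\; \mathbf t \;\mid\; \mu\mathbf t.G \;\mid\; \mathsf{end},$$ where $p\neq q$ and $I$ is finite and non-empty with pairwise distinct labels $l_i$. Local types are given by $$T ::= q!\langle U\rangle;T \mid p?\langle U\rangle;T \mid q\oplus\{l_i:T_i\}_{i\in I} \mid p\,\&\,\{l_i:T_i\}_{i\in I} \mid \mathbf t \mid \mu\mathbf t.T \mid \mathsf{end}.$$ Types are taken up to renaming of bound variables and order of branches. **Projection.** The partial projection $G{\upharpoonright}r$ is defined by $\mathbf t{\upharpoonright}r=\mathbf t$; $\mathsf{end}{\upharpoonright}r=\mathsf{end}$; $(\mu\mathbf t.G){\upharpoonright}r=\mu\mathbf t.(G{\upharpoonright}r)$ if $G{\upharpoonright}r\ne\mathbf t$, and $\mathsf{end}$ otherwise; $(p\to q:\langle U\rangle;G){\upharpoonright}r$ is $q!\langle U\rangle;(G{\upharpoonright}r)$ if $r=p$, $p?\langle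 U\rangle;(G{\upharpoonright}r)$ if $r=q$, and $G{\upharpoonright}r$ otherwise; $(p\to q:\{l_i:G_i\}_{i\in I}){\upharpoonright}r$ is $q\oplus\{l_i:G_i{\upharpoonright}r\}_{i\in I}$ if $r=p$, $p\,\&\,\{l_i:G_i{\upharpoonright}r\}_{i\in I}$ if $r=q$, and $\bigsqcup_{i\in I}G_i{\upharpoonright}r$ otherwise. Here the partial merge $\sqcup$ satisfies $$p\,\&\,\{l_k:T_k\}_{k\in K}\sqcup p\,\&\,\{l_j:T'_j\}_{j\in J}=p\,\&\big(\{l_k:T_k\sqcup T'_k\}_{k\in K\cap J}\cup\{l_k:T_k\}_{k\in K\setminus J}\cup\{l_j:T'_j\}_{j\in J\setminus K}\big),$$ is homomorphic on all other constructors (with $\mathsf{end}\sqcup\mathsf{end}=\mathsf{end}$ and $\mathbf t\sqcup\mathbf t=\mathbf t$), and is undefined in all other cases. **Global transitions.** The transitions $G\xrightarrow{g}G'$, with $g=p\to q:m$ and $\mathsf{pid}(g)=\{p,q\}$, are generated by: - $p\to q:\langle U\rangle;G\xrightarrow{p\to q:\langle U\rangle}G$; - $p\to q:\{l_i:G_i\}_{i\in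 I}\xrightarrow{p\to q:l_k}G_k$ for $k\in I$; - if $G\xrightarrow{g}G'$ and $\mathsf{pid}(g)\cap\{p,q\}=\emptyset$, then $p\to q:\langle U\rangle;G\xrightarrow{g}p\to q:\langle U\rangle;G'$; - if $G_i\xrightarrow{g}G_i'$ for all $i\in I$ and $\mathsf{pid}(g)\cap\{p,q\}=\emptyset$, then $p\to q:\{l_i:G_i\}_{i\in I}\xrightarrow{g}p\to q:\{l_i:G'_i\}_{i\in I}$; - if $G[\mu\mathbf t.G/\mathbf t]\xrightarrow{g}G'$, then $\mu\mathbf t.G\xrightarrow{g}G'$. Let $Tr(G)$ be the set of finite sequences $g_1\cdots g_n$ ($n\ge 0$) with $G\xrightarrow{g_1}\cdots\xrightarrow{g_n}G'$ for some $G'$. **Local and configuration transitions.** Local types have the transitions $q!\langle U\rangle;T\xrightarrow{q!\langle U\rangle}T$, $p?\langle U\rangle;T\xrightarrow{p?\langle U\rangle}T$, $q\oplus\{l_i:T_i\}_{i\in I}\xrightarrow{q!l_j}T_j$ and $p\,\&\,\{l_i:T_i\}_{i\in I}\xrightarrow{p?l_j}T_j$ for $j\in I$, and $\mu\mathbf t.T\xrightarrow{\ell}T'$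 whenever $T[\mu\mathbf t.T/\mathbf t]\xrightarrow{\ell}T'$. A configuration $\Delta=(T_r)_{r\in\mathcal P}$ makes a synchronous transition $\Delta\xrightarrow{q!m\cdot p?m}(T'_r)_{r\in\mathcal P}$ if $p\ne q$ are in $\mathcal P$, $T_p\xrightarrow{q!m}T'_p$, $T_q\xrightarrow{p?m}T'_q$, and $T'_r=T_r$ for all other $r$. A finite sequence of such transitions executes the configuration trace $\sigma$, a map from participants to sequences of local actions, that starts with all sequences empty and in which each transition $q!m\cdot p?m$ appends $q!m$ to $\sigma(p)$ and $p?m$ to $\sigma(q)$. Let $\mathcal T_S(\Delta)$ be the set of configuration traces that $\Delta$ executes. **Theorem.** Let $G$ be a global type, let $\mathcal P$ be the set of participants occurring in $G$, suppose that $G{\upharpoonright}p$ is defined for every $p\in\mathcal P$, and let $\Delta=(G{\upharpoonright}p)_{p\in\mathcal P}$. Then $Tr(G)$ and the synchronous traces of $\Delta$ coincide when $p\to q:m$ is identified with $q!m\cdot p?m$. That is, replacing every $p\to q:m$ by $q!m\cdot p?m$ maps $Tr(G)$ onto the set of label sequences of finite synchronous transition sequences of $\Delta$. Likewise, mapping each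 sequence of global events to the configuration trace in which every $p\to q:m$ contributes $q!m$ to $p$ and $p?m$ to $q$, in order, sends $Tr(G)$ onto $\mathcal T_S(\Delta)$. -/

import Mathlib

namespace MPST

universe u v w

/-- Contents of a message: an exchanged value type `⟨U⟩`, or a label `l`. -/
inductive Msg (Val : Type v) (Lab : Type w) : Type (max v w)
  | val (U : Val) : Msg Val Lab
  | lab (l : Lab) : Msg Val Lab

/-- A communication prefix `p → q : m`. -/
structure Event (Part : Type u) (Val : Type v) (Lab : Type w) : Type (max u v w) where
  /-- the sending participant `out(g)` -/
  out : Part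
  /-- the receiving participant `inp(g)` -/
  inp : Part
  /-- the message -/
  msg : Msg Val Lab

/-- The two participants of a prefix. -/
def Event.pid {Part : Type u} {Val : Type v} {Lab : Type w} (g : Event Part Val Lab) : Set Part :=
  {g.out, g.inp}

/-- Local actions: `send q m` is `q!m`, `recv p m` is `p?m`. -/
inductive Act (Part : Type u) (Val : Type v) (Lab : Type w) : Type (max u v w)
  | send (q : Part) (m : Msg Val Lab) : Act Part Val Lab
  | recv (p : Part) (m : Msg Val Lab) : Act Part Val Lab

/-- Global types. Recursion variables are de Bruijn indices. A branching carries a finite set of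
labels and one continuation for every label of the set, so that labels are pairwise distinct and
unordered. -/
inductive GType (Part : Type u) (Val : Type v) (Lab : Type w) : Type (max u v w)
  | comm (p q : Part) (U : Val) (G : GType Part Val Lab) : GType Part Val Lab
  | branch (p q : Part) (I : Finset Lab) (K : {l : Lab // l ∈ I} → GType Part Val Lab) :
      GType Part Val Lab
  | var (n : ℕ) : GType Part Val Lab
  | mu (G : GType Part Val Lab) : GType Part Val Lab
  | done : GType Part Val Lab

/-- Local types: `send q U T` is `q!⟨U⟩;T`, `recv p U T` is `p?⟨U⟩;T`, `sel q I K` is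
`q ⊕ {l : K l}` and `bra p I K` is `p & {l : K l}`, with `l` ranging over `I`. -/
inductive LType (Part : Type u) (Val : Type v) (Lab : Type w) : Type (max u v w)
  | send (q : Part) (U : Val) (T : LType Part Val Lab) : LType Part Val Lab
  | recv (p : Part) (U : Val) (T : LType Part Val Lab) : LType Part Val Lab
  | sel (q : Part) (I : Finset Lab) (K : {l : Lab // l ∈ I} → LType Part Val Lab) :
      LType Part Val Lab
  | bra (p : Part) (I : Finset Lab) (K : {l : Lab // l ∈ I} → LType Part Val Lab) :
      LType Part Val Lab
  | var (n : ℕ) : LType Part Val Lab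
  | mu (T : LType Part Val Lab) : LType Part Val Lab
  | done : LType Part Val Lab

/-- Extension of a renaming under a binder. -/
def upRen (ρ : ℕ → ℕ) : ℕ → ℕ
  | 0 => 0
  | n + 1 => ρ n + 1

section Syntax_

variable {Part : Type u} {Val : Type v} {Lab : Type w}

/-- Renaming of the recursion variables of a global type. -/
def GType.rename (ρ : ℕ → ℕ) : GType Part Val Lab → GType Part Val Lab
  | .comm p q U G => .comm p q U (G.rename ρ)
  | .branch p q I K => .branch p q I (fun l => (K l).rename ρ)
  | .var n => .var (ρ n)
  | .mu G => .mu (G.rename (upRen ρ))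
  | .done => .done

/-- Extension of a substitution under a binder. -/
def GType.up (s : ℕ → GType Part Val Lab) : ℕ → GType Part Val Lab
  | 0 => .var 0
  | n + 1 => (s n).rename Nat.succ

/-- Simultaneous capture-avoiding substitution. -/
def GType.subst (s : ℕ → GType Part Val Lab) : GType Part Val Lab → GType Part Val Lab
  | .comm p q U G => .comm p q U (G.subst s)
  | .branch p q I K => .branch p q I (fun l => (K l).subst s)
  | .var n => s n
  | .mu G => .mu (G.subst (GType.up s))
  | .done => .done

/-- The unfolding `G[μt.G/t]` of `μt.G`. -/
def GType.unfold (G : GType Part Val Lab) : GType Part Val Lab :=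
  G.subst (fun n => match n with
    | 0 => .mu G
    | k + 1 => .var k)

/-- Renaming of the recursion variables of a local type. -/
def LType.rename (ρ : ℕ → ℕ) : LType Part Val Lab → LType Part Val Lab
  | .send q U T => .send q U (T.rename ρ)
  | .recv p U T => .recv p U (T.rename ρ)
  | .sel q I K => .sel q I (fun l => (K l).rename ρ)
  | .bra p I K => .bra p I (fun l => (K l).rename ρ)
  | .var n => .var (ρ n)
  | .mu T => .mu (T.rename (upRen ρ))
  | .done => .done

/-- Extension of a substitution under a binder. -/
def LType.up (s : ℕ → LType Part Val Lab) : ℕ → LType Part Val Lab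
  | 0 => .var 0
  | n + 1 => (s n).rename Nat.succ

/-- Simultaneous capture-avoiding substitution. -/
def LType.subst (s : ℕ → LType Part Val Lab) : LType Part Val Lab → LType Part Val Lab
  | .send q U T => .send q U (T.subst s)
  | .recv p U T => .recv p U (T.subst s)
  | .sel q I K => .sel q I (fun l => (K l).subst s)
  | .bra p I K => .bra p I (fun l => (K l).subst s)
  | .var n => s n
  | .mu T => .mu (T.subst (LType.up s))
  | .done => .done

/-- The unfolding `T[μt.T/t]` of `μt.T`. -/
def LType.unfold (T : LType Part Val Lab) : LType Part Val Lab :=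
  T.subst (fun n => match n with
    | 0 => .mu T
    | k + 1 => .var k)

/-- Every communication is between two different participants, and every branching has at least
one branch. -/
def GType.WF : GType Part Val Lab → Prop
  | .comm p q _ G => p ≠ q ∧ G.WF
  | .branch p q I K => p ≠ q ∧ I.Nonempty ∧ ∀ l, (K l).WF
  | .var _ => True
  | .mu G => G.WF
  | .done => True

/-- The set of participants that occur in a global type. -/
def GType.participants : GType Part Val Lab → Set Part
  | .comm p q _ G => {p, q} ∪ G.participants
  | .branch p q _ K => {p, q} ∪ ⋃ l, (K l).participants
  | .var _ => ∅
  | .mu G => G.participants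
  | .done => ∅

/-- `Merge T₁ T₂ T` means that `T₁ ⊔ T₂` is defined and equal to `T`. Two inputs of labels from the
same participant are merged by taking the union of their label sets and merging the continuations
of the common labels; everything else is merged homomorphically. -/
inductive Merge : LType Part Val Lab → LType Part Val Lab → LType Part Val Lab → Prop
  | send {q : Part} {U : Val} {T₁ T₂ T : LType Part Val Lab} :
      Merge T₁ T₂ T → Merge (.send q U T₁) (.send q U T₂) (.send q U T)
  | recv {p : Part} {U : Val} {T₁ T₂ T : LType Part Val Lab} :
      Merge T₁ T₂ T → Merge (.recv p U T₁) (.recv p U T₂) (.recv p U T)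
  | sel {q : Part} {I : Finset Lab} {K₁ K₂ K : {l : Lab // l ∈ I} → LType Part Val Lab} :
      (∀ l, Merge (K₁ l) (K₂ l) (K l)) → Merge (.sel q I K₁) (.sel q I K₂) (.sel q I K)
  | bra {p : Part} {I₁ I₂ I : Finset Lab} {K₁ : {l : Lab // l ∈ I₁} → LType Part Val Lab}
      {K₂ : {l : Lab // l ∈ I₂} → LType Part Val Lab}
      {K : {l : Lab // l ∈ I} → LType Part Val Lab} :
      (∀ l, l ∈ I ↔ l ∈ I₁ ∨ l ∈ I₂) →
      (∀ (l : Lab) (h₁ : l ∈ I₁) (h₂ : l ∈ I₂) (h : l ∈ I),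
        Merge (K₁ ⟨l, h₁⟩) (K₂ ⟨l, h₂⟩) (K ⟨l, h⟩)) →
      (∀ (l : Lab) (h₁ : l ∈ I₁) (h : l ∈ I), l ∉ I₂ → K ⟨l, h⟩ = K₁ ⟨l, h₁⟩) →
      (∀ (l : Lab) (h₂ : l ∈ I₂) (h : l ∈ I), l ∉ I₁ → K ⟨l, h⟩ = K₂ ⟨l, h₂⟩) →
      Merge (.bra p I₁ K₁) (.bra p I₂ K₂) (.bra p I K)
  | var {n : ℕ} : Merge (.var n) (.var n) (.var n)
  | mu {T₁ T₂ T : LType Part Val Lab} : Merge T₁ T₂ T → Merge (.mu T₁) (.mu T₂) (.mu T)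
  | done : Merge .done .done .done

/-- `MergeList [T₁, …, Tₙ] T` means that `T₁ ⊔ (T₂ ⊔ ⋯ ⊔ Tₙ)` is defined and equal to `T`
(for `n ≥ 1`). -/
inductive MergeList : List (LType Part Val Lab) → LType Part Val Lab → Prop
  | single {T : LType Part Val Lab} : MergeList [T] T
  | cons {T₁ T₂ T : LType Part Val Lab} {L : List (LType Part Val Lab)} :
      MergeList L T₂ → Merge T₁ T₂ T → MergeList (T₁ :: L) T

/-- `Proj G r T` means that the projection of `G` onto `r` is defined and equal to `T`. In
`branchOther` the list `L` enumerates the branches. -/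
inductive Proj : GType Part Val Lab → Part → LType Part Val Lab → Prop
  | commOut {p q : Part} {U : Val} {G : GType Part Val Lab} {T : LType Part Val Lab} :
      Proj G p T → Proj (.comm p q U G) p (.send q U T)
  | commInp {p q : Part} {U : Val} {G : GType Part Val Lab} {T : LType Part Val Lab} :
      q ≠ p → Proj G q T → Proj (.comm p q U G) q (.recv p U T)
  | commOther {p q r : Part} {U : Val} {G : GType Part Val Lab} {T : LType Part Val Lab} :
      r ≠ p → r ≠ q → Proj G r T → Proj (.comm p q U G) r T
  | branchOut {p q : Part} {I : Finset Lab} {K : {l : Lab // l ∈ I} → GType Part Val Lab}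
      {F : {l : Lab // l ∈ I} → LType Part Val Lab} :
      (∀ l, Proj (K l) p (F l)) → Proj (.branch p q I K) p (.sel q I F)
  | branchInp {p q : Part} {I : Finset Lab} {K : {l : Lab // l ∈ I} → GType Part Val Lab}
      {F : {l : Lab // l ∈ I} → LType Part Val Lab} :
      q ≠ p → (∀ l, Proj (K l) q (F l)) → Proj (.branch p q I K) q (.bra p I F)
  | branchOther {p q r : Part} {I : Finset Lab} {K : {l : Lab // l ∈ I} → GType Part Val Lab}
      {F : {l : Lab // l ∈ I} → LType Part Val Lab} {L : List {l : Lab // l ∈ I}}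
      {T : LType Part Val Lab} :
      r ≠ p → r ≠ q → (∀ l, Proj (K l) r (F l)) →
      L.Nodup → (∀ l, l ∈ L) → MergeList (L.map F) T → Proj (.branch p q I K) r T
  | mu {r : Part} {G : GType Part Val Lab} {T : LType Part Val Lab} :
      Proj G r T → T ≠ .var 0 → Proj (.mu G) r (.mu T)
  | muEnd {r : Part} {G : GType Part Val Lab} :
      Proj G r (.var 0) → Proj (.mu G) r .done
  | var {r : Part} {n : ℕ} : Proj (.var n) r (.var n)
  | done {r : Part} : Proj .done r .done

/-- The labelled transition relation of global types. -/
inductive GStep : GType Part Val Lab → Event Part Val Lab → GType Part Val Lab → Prop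
  | inter {p q : Part} {U : Val} {G : GType Part Val Lab} :
      GStep (.comm p q U G) ⟨p, q, .val U⟩ G
  | selBra {p q : Part} {I : Finset Lab} {K : {l : Lab // l ∈ I} → GType Part Val Lab}
      (k : {l : Lab // l ∈ I}) :
      GStep (.branch p q I K) ⟨p, q, .lab k.1⟩ (K k)
  | iPerm {p q : Part} {U : Val} {G G' : GType Part Val Lab} {g : Event Part Val Lab} :
      GStep G g G' → ({p, q} : Set Part) ∩ g.pid = ∅ → GStep (.comm p q U G) g (.comm p q U G')
  | sbPerm {p q : Part} {I : Finset Lab} {K K' : {l : Lab // l ∈ I} → GType Part Val Lab}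
      {g : Event Part Val Lab} :
      (∀ l, GStep (K l) g (K' l)) → g.pid ∩ ({p, q} : Set Part) = ∅ →
      GStep (.branch p q I K) g (.branch p q I K')
  | unfold {G G' : GType Part Val Lab} {g : Event Part Val Lab} :
      GStep G.unfold g G' → GStep (.mu G) g G'

/-- The labelled transition relation of local types. -/
inductive LStep : LType Part Val Lab → Act Part Val Lab → LType Part Val Lab → Prop
  | lIn {p : Part} {U : Val} {T : LType Part Val Lab} :
      LStep (.recv p U T) (.recv p (.val U)) T
  | lOut {q : Part} {U : Val} {T : LType Part Val Lab} :
      LStep (.send q U T) (.send q (.val U)) T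
  | lBra {p : Part} {I : Finset Lab} {K : {l : Lab // l ∈ I} → LType Part Val Lab}
      (j : {l : Lab // l ∈ I}) : LStep (.bra p I K) (.recv p (.lab j.1)) (K j)
  | lSel {q : Part} {I : Finset Lab} {K : {l : Lab // l ∈ I} → LType Part Val Lab}
      (j : {l : Lab // l ∈ I}) : LStep (.sel q I K) (.send q (.lab j.1)) (K j)
  | lRec {T T' : LType Part Val Lab} {a : Act Part Val Lab} :
      LStep T.unfold a T' → LStep (.mu T) a T'

/-- `GRun G [g₁, …, gₙ] G'` is `G → ⋯ → G'` with labels `g₁, …, gₙ`. -/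
inductive GRun : GType Part Val Lab → List (Event Part Val Lab) → GType Part Val Lab → Prop
  | nil {G : GType Part Val Lab} : GRun G [] G
  | cons {G G₁ G₂ : GType Part Val Lab} {g : Event Part Val Lab} {t : List (Event Part Val Lab)} :
      GStep G g G₁ → GRun G₁ t G₂ → GRun G (g :: t) G₂

/-- The trace set `Tr(G)`. -/
def GType.traces (G : GType Part Val Lab) : Set (List (Event Part Val Lab)) :=
  {t | ∃ G', GRun G t G'}

/-- A configuration over a set `P` of participants. -/
abbrev Config (P : Set Part) (Val : Type v) (Lab : Type w) : Type (max u v w) :=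
  P → LType Part Val Lab

/-- The synchronous transition relation of configurations: `CStep Δ (q!m) (p?m) Δ'` when `p` does
`q!m`, another participant `q` does `p?m`, and all others stay as they are. -/
inductive CStep {P : Set Part} : Config P Val Lab → Act Part Val Lab → Act Part Val Lab →
    Config P Val Lab → Prop
  | synch {Δ Δ' : Config P Val Lab} {p q : P} {m : Msg Val Lab} :
      p ≠ q → LStep (Δ p) (.send q.1 m) (Δ' p) → LStep (Δ q) (.recv p.1 m) (Δ' q) →
      (∀ r : P, r ≠ p → r ≠ q → Δ r = Δ' r) →
      CStep Δ (.send q.1 m) (.recv p.1 m) Δ'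

/-- Finite sequences of synchronous transitions, with the list of their labels. -/
inductive CRun {P : Set Part} : Config P Val Lab → List (Act Part Val Lab × Act Part Val Lab) →
    Config P Val Lab → Prop
  | nil {Δ : Config P Val Lab} : CRun Δ [] Δ
  | cons {Δ Δ₁ Δ₂ : Config P Val Lab} {a b : Act Part Val Lab}
      {t : List (Act Part Val Lab × Act Part Val Lab)} :
      CStep Δ a b Δ₁ → CRun Δ₁ t Δ₂ → CRun Δ ((a, b) :: t) Δ₂

/-- The label sequences of the synchronous executions of a configuration. -/
def Config.runLabels {P : Set Part} (Δ : Config P Val Lab) :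
    Set (List (Act Part Val Lab × Act Part Val Lab)) :=
  {t | ∃ Δ', CRun Δ t Δ'}

/-- `Exec Δ σ Δ'`: the configuration `Δ` executes the configuration trace `σ`, a map from
participants to sequences of local actions, to `Δ'`. -/
inductive Exec {P : Set Part} : Config P Val Lab → (Part → List (Act Part Val Lab)) →
    Config P Val Lab → Prop
  | refl {Δ : Config P Val Lab} : Exec Δ (fun _ => []) Δ
  | step {Δ Δ₁ Δ₂ : Config P Val Lab} {σ σ' : Part → List (Act Part Val Lab)} {p q : Part}
      {m : Msg Val Lab} :
      Exec Δ σ Δ₁ → CStep Δ₁ (.send q m) (.recv p m) Δ₂ →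
      σ' p = σ p ++ [.send q m] → σ' q = σ q ++ [.recv p m] →
      (∀ r, r ≠ p → r ≠ q → σ' r = σ r) →
      Exec Δ σ' Δ₂

/-- The set of synchronous configuration traces of a configuration. -/
def Config.traces {P : Set Part} (Δ : Config P Val Lab) :
    Set (Part → List (Act Part Val Lab)) :=
  {σ | ∃ Δ', Exec Δ σ Δ'}

/-- The pair of local actions `q!m · p?m` identified with `p → q : m`. -/
def Event.pair (g : Event Part Val Lab) : Act Part Val Lab × Act Part Val Lab :=
  (.send g.inp g.msg, .recv g.out g.msg)

/-- The configuration trace identified with a sequence of global events: every `p → q : m`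
contributes `q!m` to the sequence of `p` and `p?m` to that of `q`. -/
def configTrace [DecidableEq Part] (t : List (Event Part Val Lab)) :
    Part → List (Act Part Val Lab) :=
  fun r => t.flatMap (fun g =>
    if r = g.out then [g.pair.1] else if r = g.inp then [g.pair.2] else [])

end Syntax_

end MPST

namespace MPST

universe u v w

section Theory

variable {Part : Type u} {Val : Type v} {Lab : Type w}

/-! ### The order of local types by available inputs -/

/-! A configuration does not remain equal to the projections of the evolving global type, for two
reasons. When a branch is chosen, a bystander keeps its merged type, which may offer more inputs
than the projection of that branch. When a global transition unfolds a recursion, it does so for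
every participant, while in the configuration the bystanders do not move. The invariant is therefore
`Impl T S`, between the projection `T` and the actual local type `S`: `T` lies below an unrolling of
`S`, in an order where larger types offer more inputs.

A merge is an upper bound in this order, and types with a common upper bound have a merge below it
(`Le.exists_merge`). This keeps projections defined along global transitions. `GStep.proj_active`
bounds the new projections of the two partners by the targets of their local actions;
`GStep.proj_passive` bounds the others by the old projection, unrolled as often as the sender
unfolds. Hence the configuration matches every global transition.

Conversely, outputs pass down from `S` to `T`, but input labels may get lost; only the fact that an
input from `p` comes first survives. That suffices for `exists_gstep`, since the sender determines
the label. The global transition found is replayed in the configuration, and as labels determine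
configuration transitions, the replay is the given one. -/

/-- `Le T S` says that `S` differs from `T` only by offering more labels at input branchings. -/
inductive Le : LType Part Val Lab → LType Part Val Lab → Prop
  | send {q : Part} {U : Val} {T S : LType Part Val Lab} :
      Le T S → Le (.send q U T) (.send q U S)
  | recv {p : Part} {U : Val} {T S : LType Part Val Lab} :
      Le T S → Le (.recv p U T) (.recv p U S)
  | sel {q : Part} {I : Finset Lab} {K M : {l : Lab // l ∈ I} → LType Part Val Lab} :
      (∀ l, Le (K l) (M l)) → Le (.sel q I K) (.sel q I M)
  | bra {p : Part} {I J : Finset Lab} {K : {l : Lab // l ∈ I} → LType Part Val Lab}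
      {M : {l : Lab // l ∈ J} → LType Part Val Lab} :
      I ⊆ J → (∀ (l : Lab) (h : l ∈ I) (h' : l ∈ J), Le (K ⟨l, h⟩) (M ⟨l, h'⟩)) →
      Le (.bra p I K) (.bra p J M)
  | var {n : ℕ} : Le (.var n) (.var n)
  | mu {T S : LType Part Val Lab} : Le T S → Le (.mu T) (.mu S)
  | done : Le .done .done

theorem Le.refl (T : LType Part Val Lab) : Le T T := by
  induction T with
  | send q U T ih => exact .send ih
  | recv p U T ih => exact .recv ih
  | sel q I K ih => exact .sel ih
  | bra p I K ih => exact .bra (fun _ h => h) (fun l h _ => ih ⟨l, h⟩)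
  | var n => exact .var
  | mu T ih => exact .mu ih
  | done => exact .done

theorem Le.trans {T S R : LType Part Val Lab} (h : Le T S) (h' : Le S R) : Le T R := by
  induction h generalizing R with
  | send _ ih => cases h' with | send h' => exact .send (ih h')
  | recv _ ih => cases h' with | recv h' => exact .recv (ih h')
  | sel _ ih => cases h' with | sel h' => exact .sel (fun l => ih l (h' l))
  | bra hI _ ih =>
    cases h' with
    | bra hJ h' => exact .bra (hI.trans hJ) (fun l h h'' => ih l h (hI h) (h' l (hI h) h''))
  | var => exact h'
  | mu _ ih => cases h' with | mu h' => exact .mu (ih h')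
  | done => exact h'

theorem Le.rename {T S : LType Part Val Lab} (h : Le T S) (ρ : ℕ → ℕ) :
    Le (T.rename ρ) (S.rename ρ) := by
  induction h generalizing ρ with
  | send _ ih => exact .send (ih ρ)
  | recv _ ih => exact .recv (ih ρ)
  | sel _ ih => exact .sel (fun l => ih l ρ)
  | bra hI _ ih => exact .bra hI (fun l h h' => ih l h h' ρ)
  | var => exact .var
  | mu _ ih => exact .mu (ih _)
  | done => exact .done

theorem Le.subst {T S : LType Part Val Lab} (h : Le T S) {s t : ℕ → LType Part Val Lab}
    (hst : ∀ n, Le (s n) (t n)) : Le (T.subst s) (S.subst t) := by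
  induction h generalizing s t with
  | send _ ih => exact .send (ih hst)
  | recv _ ih => exact .recv (ih hst)
  | sel _ ih => exact .sel (fun l => ih l hst)
  | bra hI _ ih => exact .bra hI (fun l h h' => ih l h h' hst)
  | var => exact hst _
  | mu _ ih =>
    refine .mu (ih ?_)
    rintro (_ | n)
    · exact .var
    · exact (hst n).rename _
  | done => exact .done

theorem Le.unfold {T S : LType Part Val Lab} (h : Le T S) : Le T.unfold S.unfold := by
  refine h.subst ?_
  rintro (_ | n)
  · exact .mu h
  · exact .var

/-! ### Merging is the least upper bound -/

theorem Merge.le {T₁ T₂ T : LType Part Val Lab} (h : Merge T₁ T₂ T) : Le T₁ T ∧ Le T₂ T := by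
  induction h with
  | send _ ih => exact ⟨.send ih.1, .send ih.2⟩
  | recv _ ih => exact ⟨.recv ih.1, .recv ih.2⟩
  | sel _ ih => exact ⟨.sel fun l => (ih l).1, .sel fun l => (ih l).2⟩
  | @bra p I₁ I₂ I K₁ K₂ K hI _ h₁ h₂ ih =>
    refine ⟨.bra (fun l h => (hI l).2 (.inl h)) fun l h h' => ?_,
      .bra (fun l h => (hI l).2 (.inr h)) fun l h h' => ?_⟩
    · by_cases hl : l ∈ I₂
      · exact (ih l h hl h').1
      · rw [h₁ l h h' hl]; exact .refl _
    · by_cases hl : l ∈ I₁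
      · exact (ih l hl h h').2
      · rw [h₂ l h h' hl]; exact .refl _
  | var => exact ⟨.var, .var⟩
  | mu _ ih => exact ⟨.mu ih.1, .mu ih.2⟩
  | done => exact ⟨.done, .done⟩

/-- A common bound rules out any clash of constructors. At inputs the union of the label sets stays
below the bound; common labels merge by induction, and any other label keeps its only continuation.
-/
theorem Le.exists_merge {T₁ T₂ B : LType Part Val Lab} (h₁ : Le T₁ B) (h₂ : Le T₂ B) :
    ∃ T, Merge T₁ T₂ T ∧ Le T B := by
  induction h₁ generalizing T₂ with
  | send _ ih =>
    cases h₂ with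
    | send h₂ => obtain ⟨T, hm, hle⟩ := ih h₂; exact ⟨_, .send hm, .send hle⟩
  | recv _ ih =>
    cases h₂ with
    | recv h₂ => obtain ⟨T, hm, hle⟩ := ih h₂; exact ⟨_, .recv hm, .recv hle⟩
  | sel _ ih =>
    cases h₂ with
    | sel h₂ =>
      choose F hm hle using fun l => ih l (h₂ l)
      exact ⟨_, .sel hm, .sel hle⟩
  | @bra p I₁ J K₁ M hI h ih =>
    cases h₂ with
    | @bra _ I₂ _ K₂ _ hI₂ h₂ =>
      classical
      have key : ∀ l : {l : Lab // l ∈ I₁ ∪ I₂}, ∃ X : LType Part Val Lab,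
          (∀ (a : l.1 ∈ I₁) (b : l.1 ∈ I₂), Merge (K₁ ⟨l, a⟩) (K₂ ⟨l, b⟩) X) ∧
          (∀ a : l.1 ∈ I₁, l.1 ∉ I₂ → X = K₁ ⟨l, a⟩) ∧
          (∀ b : l.1 ∈ I₂, l.1 ∉ I₁ → X = K₂ ⟨l, b⟩) ∧
          (∀ c : l.1 ∈ J, Le X (M ⟨l, c⟩)) := by
        rintro ⟨l, hl⟩
        by_cases a : l ∈ I₁
        · by_cases b : l ∈ I₂
          · obtain ⟨X, hm, hle⟩ := ih l a (hI a) (h₂ l b (hI a))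
            exact ⟨X, fun _ _ => hm, fun _ n => (n b).elim, fun _ n => (n a).elim, fun _ => hle⟩
          · exact ⟨K₁ ⟨l, a⟩, fun _ b' => (b b').elim, fun _ _ => rfl, fun _ n => (n a).elim,
              fun c => h l a c⟩
        · have b : l ∈ I₂ := (Finset.mem_union.1 hl).resolve_left a
          exact ⟨K₂ ⟨l, b⟩, fun a' => (a a').elim, fun a' => (a a').elim, fun _ _ => rfl,
            fun c => h₂ l b c⟩
      choose X hm ha hb hle using key
      exact ⟨.bra p (I₁ ∪ I₂) X,
        .bra (fun l => Finset.mem_union) (fun l a b c => hm ⟨l, c⟩ a b)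
          (fun l a c => ha ⟨l, c⟩ a) (fun l b c => hb ⟨l, c⟩ b),
        .bra (Finset.union_subset hI hI₂) (fun l c d => hle ⟨l, c⟩ d)⟩
  | var => cases h₂; exact ⟨_, .var, .var⟩
  | mu _ ih =>
    cases h₂ with
    | mu h₂ => obtain ⟨T, hm, hle⟩ := ih h₂; exact ⟨_, .mu hm, .mu hle⟩
  | done => cases h₂; exact ⟨_, .done, .done⟩

theorem MergeList.ne_nil {L : List (LType Part Val Lab)} {T : LType Part Val Lab}
    (h : MergeList L T) : L ≠ [] := by
  cases h <;> simp

theorem MergeList.le {L : List (LType Part Val Lab)} {T : LType Part Val Lab}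
    (h : MergeList L T) : ∀ S ∈ L, Le S T := by
  induction h with
  | single => intro S hS; rw [List.mem_singleton.1 hS]; exact .refl _
  | cons _ hm ih =>
    intro S hS
    rcases List.mem_cons.1 hS with rfl | hS
    · exact hm.le.1
    · exact (ih S hS).trans hm.le.2

theorem exists_mergeList {L : List (LType Part Val Lab)} {B : LType Part Val Lab}
    (hL : L ≠ []) (h : ∀ S ∈ L, Le S B) : ∃ T, MergeList L T ∧ Le T B := by
  induction L with
  | nil => exact (hL rfl).elim
  | cons S L ih =>
    rcases eq_or_ne L [] with rfl | hne
    · exact ⟨S, .single, h S (by simp)⟩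
    · obtain ⟨T, hm, hle⟩ := ih hne (fun R hR => h R (by simp [hR]))
      obtain ⟨R, hm', hle'⟩ := (h S (by simp)).exists_merge hle
      exact ⟨R, .cons hm hm', hle'⟩

/-! ### Projection commutes with substitution -/

/-- Used at variables in `Merge.subst`, where both sides receive the same arbitrary type. -/
theorem Merge.self (T : LType Part Val Lab) : Merge T T T := by
  induction T with
  | send q U T ih => exact .send ih
  | recv p U T ih => exact .recv ih
  | sel q I K ih => exact .sel ih
  | bra p I K ih =>
    exact .bra (by simp) (fun l h _ _ => ih ⟨l, h⟩) (fun _ _ _ _ => rfl) (fun _ _ _ _ => rfl)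
  | var n => exact .var
  | mu T ih => exact .mu ih
  | done => exact .done

theorem Merge.rename {T₁ T₂ T : LType Part Val Lab} (h : Merge T₁ T₂ T) (ρ : ℕ → ℕ) :
    Merge (T₁.rename ρ) (T₂.rename ρ) (T.rename ρ) := by
  induction h generalizing ρ with
  | send _ ih => exact .send (ih ρ)
  | recv _ ih => exact .recv (ih ρ)
  | sel _ ih => exact .sel (fun l => ih l ρ)
  | bra hI _ h₁ h₂ ih =>
    exact .bra hI (fun l a b c => ih l a b c ρ)
      (fun l a c n => congrArg (LType.rename ρ) (h₁ l a c n))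
      (fun l b c n => congrArg (LType.rename ρ) (h₂ l b c n))
  | var => exact .var
  | mu _ ih => exact .mu (ih _)
  | done => exact .done

theorem Merge.subst {T₁ T₂ T : LType Part Val Lab} (h : Merge T₁ T₂ T)
    (s : ℕ → LType Part Val Lab) : Merge (T₁.subst s) (T₂.subst s) (T.subst s) := by
  induction h generalizing s with
  | send _ ih => exact .send (ih s)
  | recv _ ih => exact .recv (ih s)
  | sel _ ih => exact .sel (fun l => ih l s)
  | bra hI _ h₁ h₂ ih =>
    exact .bra hI (fun l a b c => ih l a b c s)
      (fun l a c n => congrArg (LType.subst s) (h₁ l a c n))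
      (fun l b c n => congrArg (LType.subst s) (h₂ l b c n))
  | var => exact .self _
  | mu _ ih => exact .mu (ih _)
  | done => exact .done

theorem MergeList.map {f : LType Part Val Lab → LType Part Val Lab}
    (hf : ∀ T₁ T₂ T, Merge T₁ T₂ T → Merge (f T₁) (f T₂) (f T))
    {L : List (LType Part Val Lab)} {T : LType Part Val Lab} (h : MergeList L T) :
    MergeList (L.map f) (f T) := by
  induction h with
  | single => exact .single
  | cons _ hm ih => exact .cons ih (hf _ _ _ hm)

theorem Proj.rename {G : GType Part Val Lab} {r : Part} {T : LType Part Val Lab}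
    (h : Proj G r T) (ρ : ℕ → ℕ) : Proj (G.rename ρ) r (T.rename ρ) := by
  induction h generalizing ρ with
  | commOut _ ih => exact .commOut (ih ρ)
  | commInp hne _ ih => exact .commInp hne (ih ρ)
  | commOther h₁ h₂ _ ih => exact .commOther h₁ h₂ (ih ρ)
  | branchOut _ ih => exact .branchOut (fun l => ih l ρ)
  | branchInp hne _ ih => exact .branchInp hne (fun l => ih l ρ)
  | branchOther h₁ h₂ _ hn hL hm ih =>
    refine .branchOther h₁ h₂ (fun l => ih l ρ) hn hL ?_
    simpa [Function.comp_def] using hm.map (fun _ _ _ h => h.rename ρ)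
  | @mu r G T _ hne ih =>
    refine .mu (ih _) ?_
    -- Under a binder a renaming sends only 0 to 0, so the side condition survives.
    cases T with
    | var n =>
      rcases n with _ | n
      · exact (hne rfl).elim
      · simp [LType.rename, upRen]
    | _ => simp [LType.rename]
  | muEnd _ ih => exact .muEnd (ih _)
  | var => exact .var
  | done => exact .done

/-- Substitution under a binder inserts lifted types, so it cannot turn the `mu` clause of
projection into the `muEnd` clause. -/
theorem LType.rename_succ_ne (T : LType Part Val Lab) : T.rename Nat.succ ≠ .var 0 := by
  cases T <;> simp [LType.rename]

theorem Proj.subst {G : GType Part Val Lab} {r : Part} {T : LType Part Val Lab}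
    (h : Proj G r T) {s : ℕ → GType Part Val Lab} {t : ℕ → LType Part Val Lab}
    (hst : ∀ n, Proj (s n) r (t n)) : Proj (G.subst s) r (T.subst t) := by
  have up : ∀ {r : Part} {s : ℕ → GType Part Val Lab} {t : ℕ → LType Part Val Lab},
      (∀ n, Proj (s n) r (t n)) → ∀ n, Proj (GType.up s n) r (LType.up t n) := by
    rintro r s t hst (_ | n)
    · exact .var
    · exact (hst n).rename _
  induction h generalizing s t with
  | commOut _ ih => exact .commOut (ih hst)
  | commInp hne _ ih => exact .commInp hne (ih hst)
  | commOther h₁ h₂ _ ih => exact .commOther h₁ h₂ (ih hst)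
  | branchOut _ ih => exact .branchOut (fun l => ih l hst)
  | branchInp hne _ ih => exact .branchInp hne (fun l => ih l hst)
  | branchOther h₁ h₂ _ hn hL hm ih =>
    refine .branchOther h₁ h₂ (fun l => ih l hst) hn hL ?_
    simpa [Function.comp_def] using hm.map (fun _ _ _ h => h.subst t)
  | @mu r G T _ hne ih =>
    refine .mu (ih (up hst)) ?_
    cases T with
    | var n =>
      rcases n with _ | n
      · exact (hne rfl).elim
      · exact LType.rename_succ_ne _
    | _ => simp [LType.subst]
  | muEnd _ ih =>
    have h := ih (up hst)
    exact .muEnd h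
  | var => exact hst _
  | done => exact .done

theorem Proj.unfold {G : GType Part Val Lab} {r : Part} {T : LType Part Val Lab}
    (h : Proj G r T) (hne : T ≠ .var 0) : Proj G.unfold r T.unfold := by
  refine h.subst ?_
  rintro (_ | n)
  · exact .mu h hne
  · exact .var

/-- The bound variable is replaced locally by `.done`, which is the projection of `.mu G` itself. -/
theorem Proj.unfold_end {G : GType Part Val Lab} {r : Part} (h : Proj G r (.var 0)) :
    Proj G.unfold r .done := by
  refine h.subst (t := fun n => match n with
    | 0 => .done
    | k + 1 => .var k) ?_
  rintro (_ | n)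
  · exact .muEnd h
  · exact .var

/-! ### Local transitions with a count of the unfoldings -/

/-- `LStepN n T a T'` is a transition `LStep T a T'` that unfolds `n` recursions. -/
inductive LStepN : ℕ → LType Part Val Lab → Act Part Val Lab → LType Part Val Lab → Prop
  | recv {p : Part} {U : Val} {T : LType Part Val Lab} :
      LStepN 0 (.recv p U T) (.recv p (.val U)) T
  | send {q : Part} {U : Val} {T : LType Part Val Lab} :
      LStepN 0 (.send q U T) (.send q (.val U)) T
  | bra {p : Part} {I : Finset Lab} {K : {l : Lab // l ∈ I} → LType Part Val Lab}
      (l : Lab) (h : l ∈ I) : LStepN 0 (.bra p I K) (.recv p (.lab l)) (K ⟨l, h⟩)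
  | sel {q : Part} {I : Finset Lab} {K : {l : Lab // l ∈ I} → LType Part Val Lab}
      (l : Lab) (h : l ∈ I) : LStepN 0 (.sel q I K) (.send q (.lab l)) (K ⟨l, h⟩)
  | mu {n : ℕ} {T T' : LType Part Val Lab} {a : Act Part Val Lab} :
      LStepN n T.unfold a T' → LStepN (n + 1) (.mu T) a T'

theorem LStepN.lstep {n : ℕ} {T T' : LType Part Val Lab} {a : Act Part Val Lab}
    (h : LStepN n T a T') : LStep T a T' := by
  induction h with
  | recv => exact .lIn
  | send => exact .lOut
  | bra l h => exact .lBra ⟨l, h⟩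
  | sel l h => exact .lSel ⟨l, h⟩
  | mu _ ih => exact .lRec ih

theorem LStep.lstepN {T T' : LType Part Val Lab} {a : Act Part Val Lab}
    (h : LStep T a T') : ∃ n, LStepN n T a T' := by
  induction h with
  | lIn => exact ⟨_, .recv⟩
  | lOut => exact ⟨_, .send⟩
  | lBra j => exact ⟨_, .bra j.1 j.2⟩
  | lSel j => exact ⟨_, .sel j.1 j.2⟩
  | lRec _ ih => obtain ⟨n, h⟩ := ih; exact ⟨_, .mu h⟩

theorem LStepN.det {n m : ℕ} {T T₁ T₂ : LType Part Val Lab} {a : Act Part Val Lab}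
    (h : LStepN n T a T₁) (h' : LStepN m T a T₂) : n = m ∧ T₁ = T₂ := by
  induction h generalizing m with
  | recv => cases h'; exact ⟨rfl, rfl⟩
  | send => cases h'; exact ⟨rfl, rfl⟩
  | bra l h => cases h'; exact ⟨rfl, rfl⟩
  | sel l h => cases h'; exact ⟨rfl, rfl⟩
  | mu _ ih =>
    cases h' with
    | mu h' => exact ⟨congrArg (· + 1) (ih h').1, (ih h').2⟩

theorem LStep.det {T T₁ T₂ : LType Part Val Lab} {a : Act Part Val Lab}
    (h : LStep T a T₁) (h' : LStep T a T₂) : T₁ = T₂ := by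
  obtain ⟨_, h⟩ := h.lstepN
  obtain ⟨_, h'⟩ := h'.lstepN
  exact (h.det h').2

/-! ### Transitions along the order -/

theorem LStepN.le {n : ℕ} {T T' S : LType Part Val Lab} {a : Act Part Val Lab}
    (h : LStepN n T a T') (hle : Le T S) : ∃ S', LStepN n S a S' ∧ Le T' S' := by
  induction h generalizing S with
  | recv => cases hle with | recv hle => exact ⟨_, .recv, hle⟩
  | send => cases hle with | send hle => exact ⟨_, .send, hle⟩
  | bra l h => cases hle with | bra hI hle => exact ⟨_, .bra l (hI h), hle _ _ _⟩
  | sel l h => cases hle with | sel hle => exact ⟨_, .sel l h, hle _⟩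
  | mu _ ih =>
    cases hle with
    | mu hle => obtain ⟨S', h, hle'⟩ := ih hle.unfold; exact ⟨S', .mu h, hle'⟩

/-- Selections related by `Le` have equal label sets, so outputs go downwards; inputs need not,
hence `HeadRecv` below. The count is kept because `Le` relates recursions only to recursions. -/
theorem LStepN.send_of_le {n : ℕ} {T S S' : LType Part Val Lab} {q : Part} {m : Msg Val Lab}
    (h : LStepN n S (.send q m) S') (hle : Le T S) : ∃ T', LStepN n T (.send q m) T' := by
  generalize ha : Act.send q m = a at h
  induction h generalizing T with
  | recv => cases ha
  | send => cases ha; cases hle; exact ⟨_, .send⟩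
  | bra l h => cases ha
  | sel l h => cases ha; cases hle; exact ⟨_, .sel l h⟩
  | mu _ ih =>
    cases hle with
    | mu hle => obtain ⟨T', h⟩ := ih hle.unfold ha; exact ⟨T', .mu h⟩

/-- After unfolding, the type starts with an input from `p`. -/
inductive HeadRecv (p : Part) : LType Part Val Lab → Prop
  | recv {U : Val} {T : LType Part Val Lab} : HeadRecv p (.recv p U T)
  | bra {I : Finset Lab} {K : {l : Lab // l ∈ I} → LType Part Val Lab} : HeadRecv p (.bra p I K)
  | mu {T : LType Part Val Lab} : HeadRecv p T.unfold → HeadRecv p (.mu T)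

theorem LStep.headRecv {T T' : LType Part Val Lab} {p : Part} {m : Msg Val Lab}
    (h : LStep T (.recv p m) T') : HeadRecv p T := by
  generalize ha : Act.recv p m = a at h
  induction h with
  | lIn => cases ha; exact .recv
  | lOut => cases ha
  | lBra => cases ha; exact .bra
  | lSel => cases ha
  | lRec _ ih => exact .mu (ih ha)

theorem HeadRecv.of_le {T S : LType Part Val Lab} {p : Part} (h : HeadRecv p S) (hle : Le T S) :
    HeadRecv p T := by
  induction h generalizing T with
  | recv => cases hle; exact .recv
  | bra => cases hle; exact .bra
  | mu _ ih => cases hle with | mu hle => exact .mu (ih hle.unfold)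

/-! ### Unrolling the outermost recursions -/

/-- Unfolds the outermost recursion of every path and applies `f` to the result. -/
def unrollWith (f : LType Part Val Lab → LType Part Val Lab) :
    LType Part Val Lab → LType Part Val Lab
  | .send q U T => .send q U (unrollWith f T)
  | .recv p U T => .recv p U (unrollWith f T)
  | .sel q I K => .sel q I (fun l => unrollWith f (K l))
  | .bra p I K => .bra p I (fun l => unrollWith f (K l))
  | .var n => .var n
  | .mu T => f T.unfold
  | .done => .done

/-- Unfolds the first `n` recursions met on every path. -/
def unroll : ℕ → LType Part Val Lab → LType Part Val Lab
  | 0 => fun T => T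
  | n + 1 => unrollWith (unroll n)

section unroll_equations

variable (n : ℕ)

theorem unroll_send (q : Part) (U : Val) (T : LType Part Val Lab) :
    unroll n (.send q U T) = .send q U (unroll n T) := by cases n <;> rfl

theorem unroll_recv (p : Part) (U : Val) (T : LType Part Val Lab) :
    unroll n (.recv p U T) = .recv p U (unroll n T) := by cases n <;> rfl

theorem unroll_sel (q : Part) (I : Finset Lab) (K : {l : Lab // l ∈ I} → LType Part Val Lab) :
    unroll n (.sel q I K) = .sel q I (fun l => unroll n (K l)) := by cases n <;> rfl

theorem unroll_bra (p : Part) (I : Finset Lab) (K : {l : Lab // l ∈ I} → LType Part Val Lab) :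
    unroll n (.bra p I K) = .bra p I (fun l => unroll n (K l)) := by cases n <;> rfl

theorem unroll_var (k : ℕ) : unroll n (.var k : LType Part Val Lab) = .var k := by
  cases n <;> rfl

theorem unroll_done : unroll n (.done : LType Part Val Lab) = .done := by cases n <;> rfl

theorem unroll_succ_mu (T : LType Part Val Lab) : unroll (n + 1) (.mu T) = unroll n T.unfold := rfl

end unroll_equations

theorem Le.unroll {T S : LType Part Val Lab} (h : Le T S) (n : ℕ) :
    Le (unroll n T) (unroll n S) := by
  induction n generalizing T S with
  | zero => exact h
  | succ n ihn =>
    induction h with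
    | send _ ih => exact .send ih
    | recv _ ih => exact .recv ih
    | sel _ ih => exact .sel ih
    | bra hI _ ih => exact .bra hI ih
    | var => exact .var
    | mu h _ => exact ihn h.unfold
    | done => exact .done

/-- Lets the unrollings caused by successive transitions accumulate into a single one. -/
theorem unroll_unroll (m n : ℕ) (T : LType Part Val Lab) :
    unroll m (unroll n T) = unroll (n + m) T := by
  induction n generalizing T with
  | zero => rw [Nat.zero_add]; rfl
  | succ n ihn =>
    have e : n + 1 + m = n + m + 1 := by omega
    induction T with
    | send q U T ih => simp only [unroll_send, ih]
    | recv q U T ih => simp only [unroll_recv, ih]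
    | sel q I K ih => simp only [unroll_sel, ih]
    | bra q I K ih => simp only [unroll_bra, ih]
    | var k => simp only [unroll_var]
    -- The unfolding is not a subterm, so the outer induction on `n` takes over.
    | mu T _ => rw [e, unroll_succ_mu, unroll_succ_mu, ihn]
    | done => simp only [unroll_done]

/-- A recursion has exactly the transitions of its unfolding. Recursions passed before the action
use up part of `n`; the remainder `m` unrolls the continuation. -/
theorem LStep.of_unroll {n : ℕ} {T T' : LType Part Val Lab} {a : Act Part Val Lab}
    (h : LStep (unroll n T) a T') : ∃ m T₀, LStep T a T₀ ∧ T' = unroll m T₀ := by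
  induction n generalizing T with
  | zero => exact ⟨0, T', h, rfl⟩
  | succ n ihn =>
    cases T with
    | send q U T => rw [unroll_send] at h; cases h; exact ⟨_, _, .lOut, rfl⟩
    | recv q U T => rw [unroll_recv] at h; cases h; exact ⟨_, _, .lIn, rfl⟩
    | sel q I K => rw [unroll_sel] at h; cases h with | lSel j => exact ⟨_, _, .lSel j, rfl⟩
    | bra q I K => rw [unroll_bra] at h; cases h with | lBra j => exact ⟨_, _, .lBra j, rfl⟩
    | var k => rw [unroll_var] at h; cases h
    | mu T => obtain ⟨m, T₀, h₀, e⟩ := ihn h; exact ⟨m, T₀, .lRec h₀, e⟩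
    | done => rw [unroll_done] at h; cases h

theorem LStep.unroll {T T' : LType Part Val Lab} {a : Act Part Val Lab}
    (h : LStep T a T') (n : ℕ) : ∃ T'', LStep (unroll n T) a T'' := by
  induction h generalizing n with
  | lIn => rw [unroll_recv]; exact ⟨_, .lIn⟩
  | lOut => rw [unroll_send]; exact ⟨_, .lOut⟩
  | lBra j => rw [unroll_bra]; exact ⟨_, .lBra j⟩
  | lSel j => rw [unroll_sel]; exact ⟨_, .lSel j⟩
  | lRec h ih =>
    rcases n with _ | n
    · exact ⟨_, .lRec h⟩
    · exact ih n

theorem HeadRecv.unroll {T : LType Part Val Lab} {p : Part} (h : HeadRecv p T) (n : ℕ) :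
    HeadRecv p (unroll n T) := by
  induction h generalizing n with
  | recv => rw [unroll_recv]; exact .recv
  | bra => rw [unroll_bra]; exact .bra
  | mu h ih =>
    rcases n with _ | n
    · exact .mu h
    · exact ih n

/-! ### Well-formedness is preserved -/

/-- `G` is well formed and all its participants are in `Q`. -/
def GType.WFIn (Q : Set Part) (G : GType Part Val Lab) : Prop :=
  G.WF ∧ G.participants ⊆ Q

theorem GType.wfIn_comm {Q : Set Part} {p q : Part} {U : Val} {G : GType Part Val Lab} :
    (GType.comm p q U G).WFIn Q ↔ p ≠ q ∧ p ∈ Q ∧ q ∈ Q ∧ G.WFIn Q := by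
  simp only [WFIn, WF, participants, Set.union_subset_iff, Set.insert_subset_iff,
    Set.singleton_subset_iff]
  tauto

theorem GType.wfIn_branch {Q : Set Part} {p q : Part} {I : Finset Lab}
    {K : {l : Lab // l ∈ I} → GType Part Val Lab} :
    (GType.branch p q I K).WFIn Q ↔
      p ≠ q ∧ I.Nonempty ∧ p ∈ Q ∧ q ∈ Q ∧ ∀ l, (K l).WFIn Q := by
  simp only [WFIn, WF, participants, Set.union_subset_iff, Set.insert_subset_iff,
    Set.singleton_subset_iff, Set.iUnion_subset_iff, forall_and]
  tauto

theorem GType.wfIn_var {Q : Set Part} {n : ℕ} : (GType.var n : GType Part Val Lab).WFIn Q :=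
  ⟨trivial, Set.empty_subset _⟩

theorem GType.wfIn_done {Q : Set Part} : (GType.done : GType Part Val Lab).WFIn Q :=
  ⟨trivial, Set.empty_subset _⟩

theorem GType.wfIn_mu {Q : Set Part} {G : GType Part Val Lab} :
    (GType.mu G).WFIn Q ↔ G.WFIn Q := Iff.rfl

theorem GType.WFIn.rename {Q : Set Part} {G : GType Part Val Lab} (h : G.WFIn Q) (ρ : ℕ → ℕ) :
    (G.rename ρ).WFIn Q := by
  induction G generalizing ρ with
  | comm p q U G ih =>
    rw [wfIn_comm] at h
    exact wfIn_comm.2 ⟨h.1, h.2.1, h.2.2.1, ih h.2.2.2 ρ⟩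
  | branch p q I K ih =>
    rw [wfIn_branch] at h
    exact wfIn_branch.2 ⟨h.1, h.2.1, h.2.2.1, h.2.2.2.1, fun l => ih l (h.2.2.2.2 l) ρ⟩
  | var n => exact wfIn_var
  | mu G ih => exact wfIn_mu.2 (ih (wfIn_mu.1 h) _)
  | done => exact wfIn_done

theorem GType.WFIn.subst {Q : Set Part} {G : GType Part Val Lab} (h : G.WFIn Q)
    {s : ℕ → GType Part Val Lab} (hs : ∀ n, (s n).WFIn Q) : (G.subst s).WFIn Q := by
  induction G generalizing s with
  | comm p q U G ih =>
    rw [wfIn_comm] at h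
    exact wfIn_comm.2 ⟨h.1, h.2.1, h.2.2.1, ih h.2.2.2 hs⟩
  | branch p q I K ih =>
    rw [wfIn_branch] at h
    exact wfIn_branch.2 ⟨h.1, h.2.1, h.2.2.1, h.2.2.2.1, fun l => ih l (h.2.2.2.2 l) hs⟩
  | var n => exact hs n
  | mu G ih =>
    refine wfIn_mu.2 (ih (wfIn_mu.1 h) ?_)
    rintro (_ | n)
    · exact wfIn_var
    · exact (hs n).rename _
  | done => exact wfIn_done

theorem GType.WFIn.unfold {Q : Set Part} {G : GType Part Val Lab} (h : G.WFIn Q) :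
    G.unfold.WFIn Q := by
  refine h.subst ?_
  rintro (_ | n)
  · exact wfIn_mu.2 h
  · exact wfIn_var

/-- `Q` stays fixed because a configuration keeps its index set while participants may vanish from
the global type. -/
theorem GStep.wfIn {Q : Set Part} {G G' : GType Part Val Lab} {g : Event Part Val Lab}
    (h : GStep G g G') (hG : G.WFIn Q) :
    g.out ≠ g.inp ∧ g.out ∈ Q ∧ g.inp ∈ Q ∧ G'.WFIn Q := by
  induction h with
  | inter => exact GType.wfIn_comm.1 hG
  | selBra k =>
    obtain ⟨h₁, _, h₂, h₃, h₄⟩ := GType.wfIn_branch.1 hG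
    exact ⟨h₁, h₂, h₃, h₄ k⟩
  | iPerm _ _ ih =>
    obtain ⟨h₁, h₂, h₃, h₄⟩ := GType.wfIn_comm.1 hG
    obtain ⟨i₁, i₂, i₃, i₄⟩ := ih h₄
    exact ⟨i₁, i₂, i₃, GType.wfIn_comm.2 ⟨h₁, h₂, h₃, i₄⟩⟩
  | sbPerm _ _ ih =>
    -- Some branch must exist for the facts about `g` to be read off; otherwise the premise of the
    -- rule is vacuous.
    obtain ⟨h₁, ⟨l, hl⟩, h₂, h₃, h₄⟩ := GType.wfIn_branch.1 hG
    obtain ⟨i₁, i₂, i₃, -⟩ := ih ⟨l, hl⟩ (h₄ _)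
    exact ⟨i₁, i₂, i₃,
      GType.wfIn_branch.2 ⟨h₁, ⟨l, hl⟩, h₂, h₃, fun l => (ih l (h₄ l)).2.2.2⟩⟩
  | unfold _ ih => exact ih (GType.wfIn_mu.1 hG).unfold

/-! ### Projections follow the global transitions -/

/-- `g.Plays x a` says that `a` is the local action of the participant `x` in `g`. -/
def Event.Plays (g : Event Part Val Lab) (x : Part) (a : Act Part Val Lab) : Prop :=
  x = g.out ∧ a = g.pair.1 ∨ x = g.inp ∧ x ≠ g.out ∧ a = g.pair.2

theorem Event.Plays.mem_pid {g : Event Part Val Lab} {x : Part} {a : Act Part Val Lab}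
    (h : g.Plays x a) : x ∈ g.pid := by
  rcases h with ⟨rfl, -⟩ | ⟨rfl, -⟩
  · exact Or.inl rfl
  · exact Or.inr rfl

theorem Event.plays_out (g : Event Part Val Lab) : g.Plays g.out g.pair.1 := .inl ⟨rfl, rfl⟩

theorem ne_of_mem_of_inter_eq_empty {p q x : Part} {s : Set Part}
    (h : ({p, q} : Set Part) ∩ s = ∅) (hx : x ∈ s) : x ≠ p ∧ x ≠ q := by
  constructor <;> rintro rfl
  · exact (h ▸ (⟨Or.inl rfl, hx⟩ : x ∈ ({x, q} : Set Part) ∩ s) : x ∈ (∅ : Set Part))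
  · exact (h ▸ (⟨Or.inr rfl, hx⟩ : x ∈ ({p, x} : Set Part) ∩ s) : x ∈ (∅ : Set Part))

theorem Proj.branch_of_bounded {p q r : Part} {I : Finset Lab}
    {K : {l : Lab // l ∈ I} → GType Part Val Lab} {F : {l : Lab // l ∈ I} → LType Part Val Lab}
    {L : List {l : Lab // l ∈ I}} {B : LType Part Val Lab} (hp : r ≠ p) (hq : r ≠ q)
    (hF : ∀ l, Proj (K l) r (F l)) (hn : L.Nodup) (hL : ∀ l, l ∈ L) (hne : L ≠ [])
    (hB : ∀ l, Le (F l) B) : ∃ T, Proj (.branch p q I K) r T ∧ Le T B := by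
  obtain ⟨T, hm, hle⟩ := exists_mergeList (L := L.map F) (B := B) (by simpa using hne) (by
    intro S hS
    obtain ⟨l, -, rfl⟩ := List.mem_map.1 hS
    exact hB l)
  exact ⟨T, .branchOther hp hq hF hn hL hm, hle⟩

theorem MergeList.le_apply {ι : Type*} {L : List ι} {F : ι → LType Part Val Lab}
    {T : LType Part Val Lab} (h : MergeList (L.map F) T) {l : ι} (hl : l ∈ L) : Le (F l) T :=
  h.le _ (List.mem_map_of_mem hl)

/-- Below a branching, the merged projection repeats the action of each branch. By determinism all
these actions have one target, which bounds the new branch projections and so provides their merge.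
-/
theorem GStep.proj_active {G G' : GType Part Val Lab} {g : Event Part Val Lab}
    (h : GStep G g G') {x : Part} {a : Act Part Val Lab} (hx : g.Plays x a)
    {S : LType Part Val Lab} (hS : Proj G x S) :
    ∃ n S' S'', LStepN n S a S' ∧ Proj G' x S'' ∧ Le S'' S' := by
  induction h generalizing S with
  | inter =>
    rcases hx with ⟨rfl, rfl⟩ | ⟨rfl, hne, rfl⟩
    · cases hS with
      | commOut hS => exact ⟨_, _, _, .send, hS, .refl _⟩
      | commInp hne => exact (hne rfl).elim
      | commOther hne => exact (hne rfl).elim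
    · cases hS with
      | commOut hS => exact (hne rfl).elim
      | commInp _ hS => exact ⟨_, _, _, .recv, hS, .refl _⟩
      | commOther _ hne => exact (hne rfl).elim
  | selBra k =>
    rcases hx with ⟨rfl, rfl⟩ | ⟨rfl, hne, rfl⟩
    · cases hS with
      | branchOut hS => exact ⟨_, _, _, .sel k.1 k.2, hS k, .refl _⟩
      | branchInp hne => exact (hne rfl).elim
      | branchOther hne => exact (hne rfl).elim
    · cases hS with
      | branchOut hS => exact (hne rfl).elim
      | branchInp _ hS => exact ⟨_, _, _, .bra k.1 k.2, hS k, .refl _⟩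
      | branchOther _ hne => exact (hne rfl).elim
  | iPerm _ hd ih =>
    obtain ⟨hp, hq⟩ := ne_of_mem_of_inter_eq_empty hd hx.mem_pid
    cases hS with
    | commOut => exact (hp rfl).elim
    | commInp => exact (hq rfl).elim
    | commOther _ _ hS =>
      obtain ⟨n, S', S'', h₁, h₂, h₃⟩ := ih hx hS
      exact ⟨n, S', S'', h₁, .commOther hp hq h₂, h₃⟩
  | sbPerm _ hd ih =>
    rw [Set.inter_comm] at hd
    obtain ⟨hp, hq⟩ := ne_of_mem_of_inter_eq_empty hd hx.mem_pid
    cases hS with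
    | branchOut => exact (hp rfl).elim
    | branchInp => exact (hq rfl).elim
    | @branchOther _ _ _ _ _ F L _ _ _ hF hn hL hm =>
      choose n S' S'' h₁ h₂ h₃ using fun l => ih l hx (hF l)
      choose R hR hSR using fun l => (h₁ l).le (hm.le_apply (hL l))
      obtain ⟨l₀, -⟩ := List.exists_mem_of_ne_nil L (by simpa using hm.ne_nil)
      obtain ⟨T, hT, hle⟩ := Proj.branch_of_bounded (B := R l₀) hp hq h₂ hn hL
        (by simpa using hm.ne_nil)
        (fun l => ((hR l).det (hR l₀)).2 ▸ (h₃ l).trans (hSR l))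
      exact ⟨_, _, T, hR l₀, hT, hle⟩
  | unfold _ ih =>
    cases hS with
    | mu hS hne =>
      obtain ⟨n, S', S'', h₁, h₂, h₃⟩ := ih hx (hS.unfold hne)
      exact ⟨_, S', S'', .mu h₁, h₂, h₃⟩
    | muEnd hS =>
      obtain ⟨n, S', S'', h₁, -⟩ := ih hx hS.unfold_end
      cases h₁

/-- The recursions unfolded by the global transition are those the sender unfolds, whence the same
`n` for every bystander. -/
theorem GStep.proj_passive {G G' : GType Part Val Lab} {g : Event Part Val Lab}
    (h : GStep G g G') {r : Part} (hr : r ∉ g.pid) {n : ℕ} {S S' T : LType Part Val Lab}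
    (hS : Proj G g.out S) (hn : LStepN n S g.pair.1 S') (hT : Proj G r T) :
    ∃ T', Proj G' r T' ∧ Le T' (unroll n T) := by
  induction h generalizing n S S' T with
  | inter =>
    cases hT with
    | commOut => exact (hr (Or.inl rfl)).elim
    | commInp => exact (hr (Or.inr rfl)).elim
    | commOther _ _ hT =>
      dsimp only [Event.pair] at hS hn
      cases hS with
      | commOut hS => cases hn; exact ⟨_, hT, .refl _⟩
      | commInp hne => exact (hne rfl).elim
      | commOther hne => exact (hne rfl).elim
  | selBra k =>
    cases hT with
    | branchOut => exact (hr (Or.inl rfl)).elim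
    | branchInp => exact (hr (Or.inr rfl)).elim
    | branchOther _ _ hF _ hL hm =>
      dsimp only [Event.pair] at hS hn
      cases hS with
      | branchOut hS => cases hn; exact ⟨_, hF k, hm.le_apply (hL k)⟩
      | branchInp hne => exact (hne rfl).elim
      | branchOther hne => exact (hne rfl).elim
  | iPerm _ hd ih =>
    obtain ⟨hp, hq⟩ := ne_of_mem_of_inter_eq_empty hd (Event.plays_out _).mem_pid
    cases hS with
    | commOut => exact (hp rfl).elim
    | commInp => exact (hq rfl).elim
    | commOther _ _ hS =>
      cases hT with
      | commOut hT =>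
        obtain ⟨T', h₁, h₂⟩ := ih hr hS hn hT
        exact ⟨_, .commOut h₁, by rw [unroll_send]; exact .send h₂⟩
      | commInp hne hT =>
        obtain ⟨T', h₁, h₂⟩ := ih hr hS hn hT
        exact ⟨_, .commInp hne h₁, by rw [unroll_recv]; exact .recv h₂⟩
      | commOther hp' hq' hT =>
        obtain ⟨T', h₁, h₂⟩ := ih hr hS hn hT
        exact ⟨_, .commOther hp' hq' h₁, h₂⟩
  | sbPerm hK hd ih =>
    rw [Set.inter_comm] at hd
    obtain ⟨hp, hq⟩ := ne_of_mem_of_inter_eq_empty hd (Event.plays_out _).mem_pid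
    cases hS with
    | branchOut => exact (hp rfl).elim
    | branchInp => exact (hq rfl).elim
    | branchOther _ _ hF _ hL hm =>
      -- Every branch allows the output with the same `n`, so one unrolling serves all branches.
      -- This is why the sender, not the receiver, does the counting.
      choose R hR using fun l => hn.send_of_le (hm.le_apply (hL l))
      cases hT with
      | branchOut hT =>
        choose T' h₁ h₂ using fun l => ih l hr (hF l) (hR l) (hT l)
        exact ⟨_, .branchOut h₁, by rw [unroll_sel]; exact .sel h₂⟩
      | branchInp hne hT =>
        choose T' h₁ h₂ using fun l => ih l hr (hF l) (hR l) (hT l)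
        exact ⟨_, .branchInp hne h₁, by
          rw [unroll_bra]; exact .bra (fun _ h => h) (fun l h _ => h₂ ⟨l, h⟩)⟩
      | branchOther hp' hq' hT hn' hL' hm' =>
        choose T' h₁ h₂ using fun l => ih l hr (hF l) (hR l) (hT l)
        exact Proj.branch_of_bounded hp' hq' h₁ hn' hL' (by simpa using hm'.ne_nil)
          (fun l => (h₂ l).trans ((hm'.le_apply (hL' l)).unroll n))
  | unfold _ ih =>
    cases hS with
    | muEnd => cases hn
    | mu hS hne =>
      cases hn with
      | mu hn =>
        cases hT with
        | mu hT hne' =>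
          -- By definition `unroll (n + 1) (.mu T)` is `unroll n T.unfold`.
          have h := ih hr (hS.unfold hne) hn (hT.unfold hne')
          exact h
        | muEnd hT =>
          obtain ⟨T', h₁, h₂⟩ := ih hr (hS.unfold hne) hn hT.unfold_end
          exact ⟨T', h₁, by rwa [unroll_done] at h₂ ⊢⟩

/-- Passing a prefix keeps `n` and shrinks `G`; unfolding may enlarge `G` but lowers `n`. `HeadRecv`
excludes prefixes that involve `q` before its communication with `p`, and there the sender's action
supplies the message. -/
theorem exists_gstep {p q : Part} {m : Msg Val Lab} (n : ℕ) {G : GType Part Val Lab}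
    {S S' R : LType Part Val Lab} (hS : Proj G p S) (hR : Proj G q R)
    (hn : LStepN n S (.send q m) S') (hh : HeadRecv p R) : ∃ G', GStep G ⟨p, q, m⟩ G' := by
  have disj : ∀ {a b : Part}, p ≠ a → p ≠ b → q ≠ a → q ≠ b →
      ({a, b} : Set Part) ∩ (Event.mk p q m).pid = ∅ := by
    intro a b h₁ h₂ h₃ h₄
    ext x
    simp only [Event.pid, Set.mem_inter_iff, Set.mem_insert_iff, Set.mem_singleton_iff,
      Set.mem_empty_iff_false, iff_false]
    rintro ⟨rfl | rfl, rfl | rfl⟩ <;> contradiction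
  induction n generalizing G S S' R with
  | zero =>
    induction G generalizing S S' R with
    | comm a b U G ih =>
      cases hS with
      | commOut hS => cases hn; exact ⟨_, .inter⟩
      | commInp => cases hn
      | commOther hp hq hS =>
        cases hR with
        | commOut => cases hh
        | commInp => cases hh; exact (hp rfl).elim
        | commOther hp' hq' hR =>
          obtain ⟨G', h⟩ := ih hS hR hn hh
          exact ⟨_, .iPerm h (disj hp hq hp' hq')⟩
    | branch a b I K ih =>
      cases hS with
      | branchOut hS => cases hn with | sel l h => exact ⟨_, .selBra ⟨l, h⟩⟩
      | branchInp => cases hn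
      | branchOther hp hq hS _ hL hm =>
        cases hR with
        | branchOut => cases hh
        | branchInp => cases hh; exact (hp rfl).elim
        | branchOther hp' hq' hR _ hL' hm' =>
          choose F hF using fun l => (hn.send_of_le (hm.le_apply (hL l)))
          choose K' hK using fun l => ih l (hS l) (hR l) (hF l) (hh.of_le (hm'.le_apply (hL' l)))
          exact ⟨_, .sbPerm hK (by rw [Set.inter_comm]; exact disj hp hq hp' hq')⟩
    | var k => cases hS; cases hn
    | mu G ih => cases hS <;> cases hn
    | done => cases hS; cases hn
  | succ n ihn =>
    induction G generalizing S S' R with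
    | comm a b U G ih =>
      cases hS with
      | commOut hS => cases hn
      | commInp => cases hn
      | commOther hp hq hS =>
        cases hR with
        | commOut => cases hh
        | commInp => cases hh; exact (hp rfl).elim
        | commOther hp' hq' hR =>
          obtain ⟨G', h⟩ := ih hS hR hn hh
          exact ⟨_, .iPerm h (disj hp hq hp' hq')⟩
    | branch a b I K ih =>
      cases hS with
      | branchOut hS => cases hn
      | branchInp => cases hn
      | branchOther hp hq hS _ hL hm =>
        cases hR with
        | branchOut => cases hh
        | branchInp => cases hh; exact (hp rfl).elim
        | branchOther hp' hq' hR _ hL' hm' =>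
          choose F hF using fun l => (hn.send_of_le (hm.le_apply (hL l)))
          choose K' hK using fun l => ih l (hS l) (hR l) (hF l) (hh.of_le (hm'.le_apply (hL' l)))
          exact ⟨_, .sbPerm hK (by rw [Set.inter_comm]; exact disj hp hq hp' hq')⟩
    | var k => cases hS; cases hn
    | mu G ih =>
      cases hS with
      | muEnd => cases hn
      | mu hS hne =>
        cases hR with
        | muEnd => cases hh
        | mu hR hne' =>
          cases hn with
          | mu hn =>
            cases hh with
            | mu hh =>
              obtain ⟨G', h⟩ := ihn (hS.unfold hne) (hR.unfold hne') hn hh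
              exact ⟨_, .unfold h⟩
    | done => cases hS; cases hn

/-! ### Configurations that implement a global type -/

/-- `T` is implemented by `S`: up to unrolling, `S` offers at least the inputs of `T`. -/
def Impl (T S : LType Part Val Lab) : Prop := ∃ n, Le T (unroll n S)

theorem Impl.step {T T' S : LType Part Val Lab} {a : Act Part Val Lab} (h : Impl T S)
    (hT : LStep T a T') : ∃ S', LStep S a S' ∧ Impl T' S' := by
  obtain ⟨n, hle⟩ := h
  obtain ⟨k, hT⟩ := hT.lstepN
  obtain ⟨R, hR, hle'⟩ := hT.le hle
  obtain ⟨m, S', hS', rfl⟩ := hR.lstep.of_unroll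
  exact ⟨S', hS', m, hle'⟩

theorem Impl.send {T S S' : LType Part Val Lab} {q : Part} {m : Msg Val Lab} (h : Impl T S)
    (hS : LStep S (.send q m) S') : ∃ n T', LStepN n T (.send q m) T' := by
  obtain ⟨n, hle⟩ := h
  obtain ⟨R, hR⟩ := hS.unroll n
  obtain ⟨k, hR⟩ := hR.lstepN
  exact ⟨k, hR.send_of_le hle⟩

theorem Impl.headRecv {T S : LType Part Val Lab} {p : Part} (h : Impl T S)
    (hS : HeadRecv p S) : HeadRecv p T := by
  obtain ⟨n, hle⟩ := h
  exact (hS.unroll n).of_le hle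

theorem Impl.of_le {T T' S : LType Part Val Lab} (h : Impl T S) (hle : Le T' T) : Impl T' S := by
  obtain ⟨n, h⟩ := h
  exact ⟨n, hle.trans h⟩

theorem Impl.of_unroll {T S : LType Part Val Lab} (h : Impl T S) (k : ℕ) :
    Impl (unroll k T) S := by
  obtain ⟨n, h⟩ := h
  exact ⟨n + k, unroll_unroll k n S ▸ h.unroll k⟩

/-- The configuration `Δ` over `P` implements the global type `G`. -/
def Config.Implements {P : Set Part} (Δ : Config P Val Lab) (G : GType Part Val Lab) : Prop :=
  G.WFIn P ∧ ∀ r : P, ∃ T, Proj G r.1 T ∧ Impl T (Δ r)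

/-- The partners move by `GStep.proj_active`; a bystander stays put, and the unfoldings are absorbed
by the unrolling in `Impl`. -/
theorem Config.Implements.gstep {P : Set Part} {Δ : Config P Val Lab}
    {G G' : GType Part Val Lab} {g : Event Part Val Lab} (h : Δ.Implements G)
    (hg : GStep G g G') : ∃ Δ' : Config P Val Lab,
      CStep Δ g.pair.1 g.pair.2 Δ' ∧ Δ'.Implements G' := by
  obtain ⟨hG, hΔ⟩ := h
  obtain ⟨hne, hp, hq, hG'⟩ := hg.wfIn hG
  obtain ⟨Tp, hTp, hIp⟩ := hΔ ⟨g.out, hp⟩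
  obtain ⟨Tq, hTq, hIq⟩ := hΔ ⟨g.inp, hq⟩
  obtain ⟨n, Tp', Tp'', hsp, hpp, hlp⟩ := hg.proj_active g.plays_out hTp
  obtain ⟨_, Tq', Tq'', hsq, hpq, hlq⟩ :=
    hg.proj_active (x := g.inp) (.inr ⟨rfl, hne.symm, rfl⟩) hTq
  obtain ⟨Sp, hSp, hIp'⟩ := hIp.step hsp.lstep
  obtain ⟨Sq, hSq, hIq'⟩ := hIq.step hsq.lstep
  classical
  have hne' : (⟨g.out, hp⟩ : P) ≠ ⟨g.inp, hq⟩ := fun e => hne (congrArg Subtype.val e)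
  refine ⟨Function.update (Function.update Δ ⟨g.out, hp⟩ Sp) ⟨g.inp, hq⟩ Sq, ?_, hG', ?_⟩
  · refine CStep.synch (p := ⟨g.out, hp⟩) (q := ⟨g.inp, hq⟩) hne' ?_ ?_ ?_
    · rw [Function.update_of_ne hne', Function.update_self]; exact hSp
    · rw [Function.update_self]; exact hSq
    · intro r h₁ h₂; rw [Function.update_of_ne h₂, Function.update_of_ne h₁]
  · intro r
    by_cases h₂ : r = ⟨g.inp, hq⟩
    · subst h₂; rw [Function.update_self]; exact ⟨_, hpq, hIq'.of_le hlq⟩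
    rw [Function.update_of_ne h₂]
    by_cases h₁ : r = ⟨g.out, hp⟩
    · subst h₁; rw [Function.update_self]; exact ⟨_, hpp, hIp'.of_le hlp⟩
    rw [Function.update_of_ne h₁]
    obtain ⟨T, hT, hI⟩ := hΔ r
    obtain ⟨T', hT', hle⟩ := hg.proj_passive (r := r.1)
      (by rintro (e | e)
          · exact h₁ (Subtype.ext e)
          · exact h₂ (Subtype.ext e)) hTp hsp hT
    exact ⟨T', hT', (hI.of_unroll n).of_le hle⟩

/-- The two labels name both partners, and each local type is deterministic for a given action. -/
theorem CStep.det {P : Set Part} {Δ Δ₁ Δ₂ : Config P Val Lab} {a b : Act Part Val Lab}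
    (h₁ : CStep Δ a b Δ₁) (h₂ : CStep Δ a b Δ₂) : Δ₁ = Δ₂ := by
  obtain ⟨-, hp, hq, hr⟩ := h₁
  rename_i p q m
  -- The labels contain coercions, so they are made variables before the second transition is taken
  -- apart.
  generalize ha : Act.send q.1 m = a at h₂
  generalize hb : Act.recv p.1 m = b at h₂
  obtain ⟨-, hp', hq', hr'⟩ := h₂
  rename_i p' q' m'
  injection ha with e₁ e₂
  injection hb with e₃ _
  obtain rfl := Subtype.ext e₁
  obtain rfl := Subtype.ext e₃
  subst e₂
  funext r
  by_cases h : r = p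
  · subst h; exact hp.det hp'
  by_cases h' : r = q
  · subst h'; exact hq.det hq'
  rw [← hr r h h', ← hr' r h h']

theorem CStep.exists_pair {P : Set Part} {Δ Δ' : Config P Val Lab} {a b : Act Part Val Lab}
    (h : CStep Δ a b Δ') : ∃ g : Event Part Val Lab, g.out ≠ g.inp ∧ g.pair = (a, b) := by
  obtain ⟨hne, -⟩ := h
  exact ⟨⟨_, _, _⟩, fun e => hne (Subtype.ext e), rfl⟩

/-- Existence of a global transition is enough: `Config.Implements.gstep` replays it, and
`CStep.det` identifies the target with `Δ'`. -/
theorem Config.Implements.cstep {P : Set Part} {Δ Δ' : Config P Val Lab}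
    {G : GType Part Val Lab} {g : Event Part Val Lab} (h : Δ.Implements G)
    (hc : CStep Δ g.pair.1 g.pair.2 Δ') : ∃ G', GStep G g G' ∧ Δ'.Implements G' := by
  have ex : ∃ G', GStep G g G' := by
    obtain ⟨p, q, m⟩ := g
    simp only [Event.pair] at hc
    generalize ha : Act.send q m = a at hc
    generalize hb : Act.recv p m = b at hc
    obtain ⟨-, hp, hq, -⟩ := hc
    injection ha with e₁ e₂
    injection hb with e₃ _
    subst e₁ e₂ e₃
    obtain ⟨T, hT, hI⟩ := h.2 _
    obtain ⟨R, hR, hJ⟩ := h.2 _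
    obtain ⟨n, T', hn⟩ := hI.send hp
    exact exists_gstep n hT hR hn (hJ.headRecv hq.headRecv)
  obtain ⟨G', hg⟩ := ex
  obtain ⟨Δ'', hc', hI⟩ := h.gstep hg
  exact ⟨G', hg, hc.det hc' ▸ hI⟩

/-! ### Simulation of runs -/

theorem Config.Implements.grun {P : Set Part} {G G' : GType Part Val Lab}
    {t : List (Event Part Val Lab)} (hr : GRun G t G') {Δ : Config P Val Lab}
    (h : Δ.Implements G) : ∃ Δ', CRun Δ (t.map Event.pair) Δ' := by
  induction hr generalizing Δ with
  | nil => exact ⟨Δ, .nil⟩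
  | cons hg _ ih =>
    obtain ⟨Δ₁, hc, h₁⟩ := h.gstep hg
    obtain ⟨Δ', hr⟩ := ih h₁
    exact ⟨Δ', .cons hc hr⟩

theorem Config.Implements.crun {P : Set Part} {t : List (Event Part Val Lab)}
    {Δ Δ' : Config P Val Lab} (hr : CRun Δ (t.map Event.pair) Δ') {G : GType Part Val Lab}
    (h : Δ.Implements G) : ∃ G', GRun G t G' := by
  induction t generalizing Δ G with
  | nil => exact ⟨G, .nil⟩
  | cons g t ih =>
    cases hr with
    | cons hc hr =>
      obtain ⟨G₁, hg, h₁⟩ := h.cstep hc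
      obtain ⟨G', hr'⟩ := ih hr h₁
      exact ⟨G', .cons hg hr'⟩

theorem CRun.exists_events {P : Set Part} {Δ Δ' : Config P Val Lab}
    {t : List (Act Part Val Lab × Act Part Val Lab)} (h : CRun Δ t Δ') :
    ∃ s : List (Event Part Val Lab), s.map Event.pair = t := by
  induction h with
  | nil => exact ⟨[], rfl⟩
  | cons hc _ ih =>
    obtain ⟨g, -, hg⟩ := hc.exists_pair
    obtain ⟨s, rfl⟩ := ih
    exact ⟨g :: s, by rw [List.map_cons, hg]⟩

theorem Config.Implements.image_pair_traces {P : Set Part} {Δ : Config P Val Lab}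
    {G : GType Part Val Lab} (h : Δ.Implements G) :
    (List.map Event.pair) '' G.traces = Δ.runLabels := by
  ext t
  constructor
  · rintro ⟨s, ⟨G', hs⟩, rfl⟩
    exact Config.Implements.grun hs h
  · rintro ⟨Δ', hr⟩
    obtain ⟨s, rfl⟩ := hr.exists_events
    exact ⟨s, Config.Implements.crun hr h, rfl⟩

/-! ### Configuration traces -/

theorem crun_append {P : Set Part} {Δ Δ₂ : Config P Val Lab}
    {s t : List (Act Part Val Lab × Act Part Val Lab)} :
    CRun Δ (s ++ t) Δ₂ ↔ ∃ Δ₁, CRun Δ s Δ₁ ∧ CRun Δ₁ t Δ₂ := by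
  induction s generalizing Δ with
  | nil =>
    refine ⟨fun h => ⟨Δ, .nil, h⟩, ?_⟩
    rintro ⟨Δ₁, h, h'⟩
    cases h
    exact h'
  | cons x s ih =>
    constructor
    · intro h
      cases h with
      | cons hc h =>
        obtain ⟨Δ₁, h₁, h₂⟩ := ih.1 h
        exact ⟨Δ₁, .cons hc h₁, h₂⟩
    · rintro ⟨Δ₁, h, h'⟩
      cases h with
      | cons hc h => exact .cons hc (ih.2 ⟨Δ₁, h, h'⟩)

theorem configTrace_concat [DecidableEq Part] (t : List (Event Part Val Lab))
    (g : Event Part Val Lab) (r : Part) : configTrace (t ++ [g]) r = configTrace t r ++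
      (if r = g.out then [g.pair.1] else if r = g.inp then [g.pair.2] else []) := by
  simp [configTrace]

/-- A configuration trace forgets the interleaving of participants; the list `t` retains it. -/
theorem exec_iff [DecidableEq Part] {P : Set Part} {Δ Δ' : Config P Val Lab}
    {σ : Part → List (Act Part Val Lab)} :
    Exec Δ σ Δ' ↔ ∃ t : List (Event Part Val Lab),
      CRun Δ (t.map Event.pair) Δ' ∧ configTrace t = σ := by
  constructor
  · intro h
    induction h with
    | refl => exact ⟨[], .nil, rfl⟩
    | @step Δ₁ Δ₂ σ σ' p q m _ hc hp hq hr ih =>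
      obtain ⟨t, ht, rfl⟩ := ih
      obtain ⟨g, hne, hg⟩ := hc.exists_pair
      have hpq : p ≠ q := by
        rintro rfl
        simp only [Event.pair, Prod.mk.injEq, Act.send.injEq, Act.recv.injEq] at hg
        exact hne (hg.2.1.trans hg.1.1.symm)
      refine ⟨t ++ [⟨p, q, m⟩], ?_, ?_⟩
      · rw [List.map_append, crun_append]
        exact ⟨_, ht, .cons hc .nil⟩
      · funext r
        rw [configTrace_concat]
        by_cases h₁ : r = p
        · subst h₁; simp [hp, Event.pair]
        by_cases h₂ : r = q
        · subst h₂; simp [hq, h₁, Event.pair]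
        · simp [h₁, h₂, hr r h₁ h₂]
  · rintro ⟨t, ht, rfl⟩
    -- `Exec` grows at the end and `CRun` at the front.
    induction t using List.reverseRecOn generalizing Δ' with
    | nil => cases ht; exact .refl
    | append_singleton t g ih =>
      rw [List.map_append, crun_append] at ht
      obtain ⟨Δ₁, h₁, h₂⟩ := ht
      have hc : CStep Δ₁ g.pair.1 g.pair.2 Δ' := by
        cases h₂ with
        | cons hc h => cases h; exact hc
      obtain ⟨g', hne, hg⟩ := hc.exists_pair
      -- `configTrace` tests for the sender first, so the receiver must differ from it.
      have hne' : g.inp ≠ g.out := by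
        simp only [Event.pair, Prod.mk.injEq, Act.send.injEq, Act.recv.injEq] at hg
        rw [← hg.1.1, ← hg.2.1]
        exact hne.symm
      refine .step (p := g.out) (q := g.inp) (m := g.msg) (ih h₁) hc ?_ ?_ ?_
      · simp [configTrace_concat, Event.pair]
      · simp [configTrace_concat, Event.pair, hne']
      · intro r h h'; simp [configTrace_concat, h, h']

/-- `configTrace` need not be injective, but `Event.pair` is: the list of events behind an execution
is itself a trace of `G`. -/
theorem image_configTrace_traces [DecidableEq Part] {P : Set Part} {Δ : Config P Val Lab}
    {G : GType Part Val Lab} (h : (List.map Event.pair) '' G.traces = Δ.runLabels) :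
    configTrace '' G.traces = Δ.traces := by
  have inj : Function.Injective (Event.pair : Event Part Val Lab → _) := by
    rintro ⟨p, q, m⟩ ⟨p', q', m'⟩ e
    simp only [Event.pair, Prod.mk.injEq, Act.send.injEq, Act.recv.injEq] at e
    obtain ⟨⟨rfl, rfl⟩, rfl, -⟩ := e
    rfl
  ext σ
  constructor
  · rintro ⟨t, ht, rfl⟩
    obtain ⟨Δ', hr⟩ := h ▸ Set.mem_image_of_mem (List.map Event.pair) ht
    exact ⟨Δ', exec_iff.2 ⟨t, hr, rfl⟩⟩
  · rintro ⟨Δ', he⟩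
    obtain ⟨t, hr, rfl⟩ := exec_iff.1 he
    have : t.map Event.pair ∈ (List.map Event.pair) '' G.traces := h ▸ ⟨Δ', hr⟩
    exact ⟨t, (inj.list_map.mem_set_image).1 this, rfl⟩

end Theory

end MPST

theorem theorem1 {Part Val Lab : Type*} [DecidableEq Part]
    (G : MPST.GType Part Val Lab) (hG : G.WF)
    (Δ : MPST.Config G.participants Val Lab)
    (hΔ : ∀ p : G.participants, MPST.Proj G p.1 (Δ p)) :
    (List.map MPST.Event.pair) '' G.traces = MPST.Config.runLabels Δ ∧
      MPST.configTrace '' G.traces = MPST.Config.traces Δ := by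
  -- Initially each projection implements itself, with no unrolling.
  have h : Δ.Implements G := ⟨⟨hG, subset_rfl⟩, fun r => ⟨Δ r, hΔ r, 0, .refl _⟩⟩
  exact ⟨h.image_pair_traces, MPST.image_configTrace_traces h.image_pair_traces⟩
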